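/- **Setting.** There are $n\ge 1$ nodes, each with its own chain; $b_{q,i}$ ($i\ge 0$) is the block of height $i$ in the chain of node $q$. Let $f_{\max}=\lfloor (n-1)/3\rfloor$ and $\Phi=2f_{\max}+1$. At most $f_{\max}$ nodes are Byzantine, the others are correct. Blocks ack other blocks: $b_{q,i+1}$ acks $b_{q,i}$, other acks are arbitrary, and the directed graph of acks has no cycle. "Directly or indirectly acks" means the reflexive-transitive closure of "acks". *Views.* At any moment a node $p$ has received a finite set of blocks and has output some of them. $\mathcal P_p$ is the set of pending blocks (received, not output), and $\mathcal C_p$ is the set of candidates: pending blocks that ack only blocks that have been output. Put $$ANS_p(b)=\{q:\exists\, b_{q,k}\in\mathcal P_p \text{ that directly or indirectly acks } b\}\cup\{p\},\qquad ANS_p=\bigcup_{b\in\mathcal C_p}ANS_p(b).$$ $AHV_p(b)[q]$ is $\bot$ if $q\notin ANS_p$; it is $k$ if $k=\min\{i:b_{q,i}\in\mathcal P_p\}$ exists and $b_{q,k}$ directly or indirectly acks $b$; it is $\infty$ otherwise. $\#AHV_p(b)$ is the number of integer entries of $AHV_p(b)$, and $c_p(b_1,b_2)=|\{q:AHV_p(b_1)[q]<AHV_p(b_2)[q]\}|$.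 Then $Grade_p(b_1,b_2)$ is $1$ if $c_p(b_1,b_2)>\Phi$; otherwise it is $0$ if $c_p(b_1,b_2)\le\Phi-(n-|ANS_p|)$; otherwise it is $\bot$. The preceding set is $\mathcal A_p=\{b\in\mathcal C_p: Grade_p(b',b)=0\ \forall b'\in\mathcal C_p\}$. *Output criterion.* The criterion holds at $p$ if both of the following hold. - Internal stability: for every $b\in\mathcal C_p\setminus\mathcal A_p$ there is $b'\in\mathcal A_p$ with $Grade_p(b',b)=1$. - External stability: (a) $|ANS_p|=n$, or (b) $\#AHV_p(b)>\Phi$ for some $b\in\mathcal A_p$, and $|ANS_p(b)|\ge n-\Phi$ for all $b\in\mathcal A_p$. *Algorithm.* Node $p$ starts with no blocks and takes in the blocks it receives one at a time, in the order of receipt (blocks of the same chain by height, other ties in any order). After each block, as long as the criterion holds, $p$ immediately outputs the set $\mathcal A_p$. *Timing.* Every chain produces blocks of all heights by Byzantine agreement (BA). A correct node receives no block before it is issued, receives the blocks of each chain in the order of their heights, and receives only finitely many blocks in bounded time. The real numbers $\Delta_{BA}$ and $\lambda$ bound the BA processing time in the following sense. The BA for $b_{j,0}$ is under way from time $0$,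 and the BA for $b_{j,k+1}$ from the time at which the first correct node receives $b_{j,k}$. From then on it takes at most $\Delta_{BA}$ until the block is issued. Each correct node receives a block within $\Delta_{BA}+\lambda$ after it is issued. **Theorem (Liveness for total ordering).** Let $p$ be a correct node. Then in every time interval $[a,b]$ with $a\ge 0$ and $b-a\ge 2\Delta_{BA}+\lambda$ there is a time at which the output criterion holds at $p$ and the set $\mathcal A_p$ that $p$ then outputs is non-empty. -/

import Mathlib

namespace Dexon

/-- `(q, i)` is the block `b_{q,i}`: the block of height `i` in the chain of node `q`. -/
abbrev Block (Node : Type*) := Node × ℕ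

/-- The blocklattice: single chains (one for each node, on whose blocks the nodes agree) whose
blocks are connected by acks. A block acks its predecessor in its own chain, and the acks
form a directed acyclic graph. -/
structure Blocklattice (Node : Type*) where
  Acks : Block Node → Block Node → Prop
  acks_parent : ∀ (q : Node) (i : ℕ), Acks (q, i + 1) (q, i)
  acyclic : ∀ b : Block Node, ¬ Relation.TransGen Acks b b

/-- Direct or indirect ack (transitive law of ack). Every block counts as acking itself, so that
the issuer of a candidate block belongs to its acking node set. -/
def Blocklattice.AcksStar {Node : Type*} (L : Blocklattice Node) :
    Block Node → Block Node → Prop :=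
  Relation.ReflTransGen L.Acks

/-- The local view of a node: the blocks it has received, and those among them which it has
already output into its compaction chain. -/
structure View (Node : Type*) where
  received : Finset (Block Node)
  output : Finset (Block Node)

section Ordering

variable {Node : Type*} [Fintype Node]

open scoped Classical in
/-- Pending blocks `𝒫_p`: received and not yet output. -/
noncomputable def View.pending (v : View Node) : Finset (Block Node) :=
  v.received \ v.output

open scoped Classical in
/-- Candidate blocks `𝒞_p`: pending blocks that only ack blocks that have been output. -/
noncomputable def View.candidates (v : View Node) (L : Blocklattice Node) :
    Finset (Block Node) :=
  v.pending.filter fun b => ∀ b', L.Acks b b' → b' ∈ v.output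

open scoped Classical in
/-- `ANS_p(b)`: the nodes with a pending block that acks `b` directly or indirectly, and `p`. -/
noncomputable def View.ANS (v : View Node) (L : Blocklattice Node) (p : Node)
    (b : Block Node) : Finset Node :=
  Finset.univ.filter fun q => (∃ k, (q, k) ∈ v.pending ∧ L.AcksStar (q, k) b) ∨ q = p

open scoped Classical in
/-- The global acking node set `ANS_p`, the union of `ANS_p(b)` over the candidates `b`. -/
noncomputable def View.globalANS (v : View Node) (L : Blocklattice Node) (p : Node) :
    Finset Node :=
  (v.candidates L).biUnion fun b => v.ANS L p b

/-- `k` is the least height of a pending block of node `q`. -/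
def View.IsFirstPending (v : View Node) (q : Node) (k : ℕ) : Prop :=
  IsLeast {i : ℕ | (q, i) ∈ v.pending} k

open scoped Classical in
/-- The acking block-height vector `AHV_p(b)`, with entries in `ℕ ∪ {⊥, ∞}` (`∞` is `⊤ : ℕ∞`).
Note that whether an entry is `⊥` does not depend on `b`. -/
noncomputable def View.AHV (v : View Node) (L : Blocklattice Node) (p : Node)
    (b : Block Node) (q : Node) : WithBot ℕ∞ :=
  if q ∉ v.globalANS L p then ⊥
  else if h : ∃ k : ℕ, v.IsFirstPending q k ∧ L.AcksStar (q, k) b then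
    ((h.choose : ℕ∞) : WithBot ℕ∞)
  else ((⊤ : ℕ∞) : WithBot ℕ∞)

open scoped Classical in
/-- `#AHV_p(b)`: the number of integer entries of `AHV_p(b)`. -/
noncomputable def View.numAHV (v : View Node) (L : Blocklattice Node) (p : Node)
    (b : Block Node) : ℕ :=
  (Finset.univ.filter fun q : Node =>
    v.AHV L p b q ≠ ⊥ ∧ v.AHV L p b q ≠ ((⊤ : ℕ∞) : WithBot ℕ∞)).card

open scoped Classical in
/-- `|{j : AHV_p(b₁)[j] < AHV_p(b₂)[j]}|`. -/
noncomputable def View.lowerCount (v : View Node) (L : Blocklattice Node) (p : Node)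
    (b₁ b₂ : Block Node) : ℕ :=
  (Finset.univ.filter fun q : Node => v.AHV L p b₁ q < v.AHV L p b₂ q).card

/-- `Precede_p(b₁, b₂) ∈ {1, -1, 0}`. -/
noncomputable def View.precede (v : View Node) (L : Blocklattice Node) (Φ : ℕ) (p : Node)
    (b₁ b₂ : Block Node) : ℤ :=
  if Φ < v.lowerCount L p b₁ b₂ then 1
  else if Φ < v.lowerCount L p b₂ b₁ then -1
  else 0

open scoped Classical in
/-- `Grade_p(b₁, b₂) ∈ {1, 0, ⊥}`: `1` if `b₁` precedes `b₂` whatever `p` receives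
next, `0` if `b₁` cannot precede `b₂` whatever `p` receives next, `⊥` otherwise.
Entries of the height vectors other than `⊥` do not change when further blocks are received, and
only the `n - |ANS_p|` entries `⊥` can still add to the count; so the value is `1` if the count
already exceeds `Φ`, and it is `0` if the count is at most `Φ - (n - |ANS_p|)`. -/
noncomputable def View.grade (v : View Node) (L : Blocklattice Node) (Φ : ℕ) (p : Node)
    (b₁ b₂ : Block Node) : WithBot ℕ :=
  if v.precede L Φ p b₁ b₂ = 1 then 1
  else if (v.lowerCount L p b₁ b₂ : ℤ)
      ≤ (Φ : ℤ) - ((Fintype.card Node : ℤ) - ((v.globalANS L p).card : ℤ)) then 0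
  else ⊥

open scoped Classical in
/-- The preceding set `𝒜_p`: the candidates `b` with `Grade_p(b', b) = 0` for all
candidates `b'`. -/
noncomputable def View.preceding (v : View Node) (L : Blocklattice Node) (Φ : ℕ) (p : Node) :
    Finset (Block Node) :=
  (v.candidates L).filter fun b => ∀ b' ∈ v.candidates L, v.grade L Φ p b' b = 0

def View.InternalStability (v : View Node) (L : Blocklattice Node) (Φ : ℕ) (p : Node) : Prop :=
  ∀ b ∈ v.candidates L, b ∉ v.preceding L Φ p →
    ∃ b' ∈ v.preceding L Φ p, v.grade L Φ p b' b = 1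

/-- External stability (a), normal delivery: `|ANS_p| = n`. -/
def View.NormalStability (v : View Node) (L : Blocklattice Node) (p : Node) : Prop :=
  (v.globalANS L p).card = Fintype.card Node

/-- External stability (b), early delivery. -/
def View.EarlyStability (v : View Node) (L : Blocklattice Node) (Φ : ℕ) (p : Node) : Prop :=
  (∃ b ∈ v.preceding L Φ p, Φ < v.numAHV L p b) ∧
    ∀ b ∈ v.preceding L Φ p,
      (Fintype.card Node : ℤ) - (Φ : ℤ) ≤ ((v.ANS L p b).card : ℤ)

/-- The output criterion: internal stability and external stability. -/
def View.Criterion (v : View Node) (L : Blocklattice Node) (Φ : ℕ) (p : Node) : Prop :=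
  v.InternalStability L Φ p ∧ (v.NormalStability L p ∨ v.EarlyStability L Φ p)

open scoped Classical in
noncomputable def View.receive (v : View Node) (b : Block Node) : View Node :=
  ⟨insert b v.received, v.output⟩

open scoped Classical in
/-- If the criterion holds, the preceding set is output; otherwise nothing happens. -/
noncomputable def View.deliver (L : Blocklattice Node) (Φ : ℕ) (p : Node) (v : View Node) :
    View Node :=
  if v.Criterion L Φ p then ⟨v.received, v.output ∪ v.preceding L Φ p⟩ else v

/-- Output for as long as the criterion holds. Every output removes a pending block, so the number
of received blocks bounds the number of outputs. -/
noncomputable def View.deliverAll (L : Blocklattice Node) (Φ : ℕ) (p : Node) (v : View Node) :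
    View Node :=
  (View.deliver L Φ p)^[v.received.card] v

/-- The view of `p` after it has run the total ordering algorithm on the first `m` blocks of the
input sequence `inp`. -/
noncomputable def viewAfter (L : Blocklattice Node) (Φ : ℕ) (p : Node) (inp : ℕ → Block Node) :
    ℕ → View Node
  | 0 => ⟨∅, ∅⟩
  | m + 1 => ((viewAfter L Φ p inp m).receive (inp m)).deliverAll L Φ p

end Ordering

/-- `f_max = ⌊(n - 1) / 3⌋`. -/
def fmax (Node : Type*) [Fintype Node] : ℕ := (Fintype.card Node - 1) / 3

/-- The threshold `Φ = 2 f_max + 1`. -/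
def threshold (Node : Type*) [Fintype Node] : ℕ := 2 * fmax Node + 1

/-- A run of the system: the blocklattice that arises, the set of Byzantine nodes, the time
`issueTime b` at which the block `b` is issued (is selected by the Byzantine agreement of its chain),
and the time `recvTime q b` at which node `q` receives it. A correct node receives
no block before it is issued, receives the blocks of a chain in the order of their heights, and
receives finitely many blocks in bounded time. -/
structure Run (Node : Type*) [Fintype Node] where
  lattice : Blocklattice Node
  byzantine : Finset Node
  card_byzantine : byzantine.card ≤ fmax Node
  issueTime : Block Node → ℝ
  recvTime : Node → Block Node → ℝ
  issue_le_recv : ∀ q ∉ byzantine, ∀ b, issueTime b ≤ recvTime q b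
  recv_mono : ∀ q ∉ byzantine, ∀ (j : Node) (k : ℕ), recvTime q (j, k) ≤ recvTime q (j, k + 1)
  recv_finite : ∀ q ∉ byzantine, ∀ T : ℝ, {b | recvTime q b ≤ T}.Finite

namespace Run

variable {Node : Type*} [Fintype Node]

/-- The bound on the processing time of the Byzantine agreement (BA) of the chains, which is also
their liveness. The agreement on the first block of a chain is under way at time `0`, the agreement
on a later block as soon as a correct node has received its predecessor; from then on the
agreement takes at most `ΔBA` to issue the block; and each correct node receives a block within
`ΔBA + lam` after it is issued. -/
structure BATimeBound (S : Run Node) (ΔBA lam : ℝ) : Prop where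
  issue_first : ∀ j : Node, S.issueTime (j, 0) ≤ ΔBA
  issue_next : ∀ q ∉ S.byzantine, ∀ (j : Node) (k : ℕ),
    S.issueTime (j, k + 1) ≤ S.recvTime q (j, k) + ΔBA
  recv_le : ∀ q ∉ S.byzantine, ∀ b : Block Node,
    S.recvTime q b ≤ S.issueTime b + (ΔBA + lam)

/-- `inp` lists the blocks in the order in which `p` feeds them to its total ordering algorithm, one
block per iteration: by the time of their receipt, and blocks of the same chain by height. -/
structure IsInputOrder (S : Run Node) (p : Node) (inp : ℕ → Block Node) : Prop where
  bijective : Function.Bijective inp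
  recv_mono : ∀ m m', m ≤ m' → S.recvTime p (inp m) ≤ S.recvTime p (inp m')
  height_mono : ∀ m m', m < m' → (inp m).1 = (inp m').1 → (inp m).2 < (inp m').2

/-- At time `t` the criterion holds at `p`, and `B` is the preceding set that `p` then
outputs: `B` is the set output in one of the rounds of output (number `r`) that follow the
receipt of a block (number `m` in the input) at time `t`. -/
def CriterionAt (S : Run Node) (p : Node) (inp : ℕ → Block Node) (t : ℝ)
    (B : Finset (Block Node)) : Prop :=
  ∃ m r : ℕ, S.recvTime p (inp m) = t ∧
    let v := (View.deliver S.lattice (threshold Node) p)^[r]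
      ((viewAfter S.lattice (threshold Node) p inp m).receive (inp m))
    v.Criterion S.lattice (threshold Node) p ∧ B = v.preceding S.lattice (threshold Node) p

end Run

end Dexon

namespace Dexon

section Lattice

variable {Node : Type*}

/-! Suppose nothing non-empty is output during `[a, b]`. The interval is long enough for `p` to
receive a block of every chain in it (`exists_recvTime_mem_Icc`). Fix one such block per chain. None
of them is output, so when the last of them arrives every chain has a pending block.

In such a view the criterion holds with a non-empty preceding set, which is a contradiction.
Descending along acks from the lowest pending block of a chain ends at a candidate, so `ANS_p`
contains all nodes and every grade is 0 or 1. Two height vectors can differ at a node outside `⊥`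
only as integer against `∞`. Hence the nodes counted for "`b₁` before `b₂`" and those for "`b₂`
before `b₃`" are disjoint, and as `2(Φ + 1) > n` the precedence relation has no two consecutive
steps. So whatever precedes another candidate is itself unpreceded: this is internal stability, and
it makes the preceding set non-empty. -/

theorem Blocklattice.acksStar_of_le (L : Blocklattice Node) (q : Node) {i k : ℕ} (h : i ≤ k) :
    L.AcksStar (q, k) (q, i) := by
  induction k, h using Nat.le_induction with
  | base => exact Relation.ReflTransGen.refl
  | succ k _ ih => exact Relation.ReflTransGen.head (L.acks_parent q k) ih

end Lattice

section Pending

variable {Node : Type*}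

theorem View.mem_pending {v : View Node} {b : Block Node} :
    b ∈ v.pending ↔ b ∈ v.received ∧ b ∉ v.output := by
  simp [View.pending]

theorem View.mem_candidates {v : View Node} {L : Blocklattice Node} {b : Block Node} :
    b ∈ v.candidates L ↔ b ∈ v.pending ∧ ∀ b', L.Acks b b' → b' ∈ v.output := by
  simp [View.candidates]

end Pending

/-! ### Views under the algorithm, and the criterion in a single view. -/

section Views

variable {Node : Type*} [Fintype Node]

theorem View.mem_preceding {v : View Node} {L : Blocklattice Node} {Φ : ℕ} {p : Node}
    {b : Block Node} :
    b ∈ v.preceding L Φ p ↔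
      b ∈ v.candidates L ∧ ∀ b' ∈ v.candidates L, v.grade L Φ p b' b = 0 := by
  simp [View.preceding]

theorem View.output_subset_received_deliver {v : View Node} (h : v.output ⊆ v.received)
    (L : Blocklattice Node) (Φ : ℕ) (p : Node) :
    (v.deliver L Φ p).output ⊆ (v.deliver L Φ p).received := by
  classical
  unfold View.deliver
  split_ifs with hc
  · intro x hx
    rcases Finset.mem_union.1 hx with hx | hx
    · exact h hx
    · exact (mem_pending.1 (mem_candidates.1 (mem_preceding.1 hx).1).1).1
  · exact h

theorem View.output_subset_received_iterate_deliver {v : View Node} (h : v.output ⊆ v.received)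
    (L : Blocklattice Node) (Φ : ℕ) (p : Node) (r : ℕ) :
    ((View.deliver L Φ p)^[r] v).output ⊆ ((View.deliver L Φ p)^[r] v).received := by
  induction r with
  | zero => exact h
  | succ r ih =>
    rw [Function.iterate_succ_apply']
    exact output_subset_received_deliver ih L Φ p

theorem View.received_deliver (v : View Node) (L : Blocklattice Node) (Φ : ℕ) (p : Node) :
    (v.deliver L Φ p).received = v.received := by
  unfold View.deliver
  split_ifs <;> rfl

theorem View.received_iterate_deliver (v : View Node) (L : Blocklattice Node) (Φ : ℕ) (p : Node)
    (r : ℕ) : ((View.deliver L Φ p)^[r] v).received = v.received := by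
  induction r with
  | zero => rfl
  | succ r ih => rw [Function.iterate_succ_apply', received_deliver, ih]

theorem View.deliver_eq_self {v : View Node} {L : Blocklattice Node} {Φ : ℕ} {p : Node}
    (h : v.Criterion L Φ p → ¬ (v.preceding L Φ p).Nonempty) : v.deliver L Φ p = v := by
  classical
  unfold View.deliver
  split_ifs with hc
  · rw [Finset.not_nonempty_iff_eq_empty.1 (h hc), Finset.union_empty]
  · rfl

theorem output_subset_received_viewAfter (L : Blocklattice Node) (Φ : ℕ) (p : Node)
    (inp : ℕ → Block Node) (m : ℕ) :
    (viewAfter L Φ p inp m).output ⊆ (viewAfter L Φ p inp m).received := by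
  classical
  induction m with
  | zero => simp [viewAfter]
  | succ m ih =>
    exact View.output_subset_received_iterate_deliver
      (by exact fun _ hx => Finset.mem_insert.2 (Or.inr (ih hx))) L Φ p _

theorem mem_received_viewAfter {L : Blocklattice Node} {Φ : ℕ} {p : Node}
    {inp : ℕ → Block Node} {m : ℕ} {b : Block Node} :
    b ∈ (viewAfter L Φ p inp m).received ↔ ∃ i < m, inp i = b := by
  classical
  induction m with
  | zero => simp [viewAfter]
  | succ m ih =>
    rw [viewAfter, View.deliverAll, View.received_iterate_deliver, View.receive,
      Finset.mem_insert, ih]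
    constructor
    · rintro (rfl | ⟨i, hi, rfl⟩)
      · exact ⟨m, m.lt_succ_self, rfl⟩
      · exact ⟨i, hi.trans m.lt_succ_self, rfl⟩
    · rintro ⟨i, hi, rfl⟩
      rcases Nat.lt_succ_iff_lt_or_eq.1 hi with hi | rfl
      · exact Or.inr ⟨i, hi, rfl⟩
      · exact Or.inl rfl

/-- The output does not change while no round of output is non-empty. -/
theorem output_viewAfter_eq {L : Blocklattice Node} {Φ : ℕ}
    {p : Node} {inp : ℕ → Block Node} {m₀ m : ℕ} (hm : m₀ ≤ m)
    (h : ∀ i, m₀ ≤ i → i < m →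
      let v := (viewAfter L Φ p inp i).receive (inp i)
      v.Criterion L Φ p → ¬ (v.preceding L Φ p).Nonempty) :
    (viewAfter L Φ p inp m).output = (viewAfter L Φ p inp m₀).output := by
  induction m, hm using Nat.le_induction with
  | base => rfl
  | succ m hm ih =>
    rw [← ih fun i hi him => h i hi (him.trans m.lt_succ_self), viewAfter, View.deliverAll]
    -- The first round leaves the view unchanged, hence so do all later ones.
    rw [Function.iterate_fixed (View.deliver_eq_self (h m hm m.lt_succ_self))]
    rfl

/-- In a view in which every chain has a pending block and whose received blocks form initial
segments of the chains, every node is in the acking node set of a candidate. -/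
theorem View.exists_candidate_mem_ANS {v : View Node} (L : Blocklattice Node) (p : Node)
    (hrec : ∀ (q : Node) (i k : ℕ), i ≤ k → (q, k) ∈ v.received → (q, i) ∈ v.received)
    (hpend : ∀ q : Node, ∃ k, (q, k) ∈ v.pending) (q : Node) :
    ∃ c ∈ v.candidates L, q ∈ v.ANS L p c := by
  classical
  let h : Node → ℕ := fun q => Nat.find (hpend q)
  have hmem : ∀ q, (q, h q) ∈ v.pending := fun q => Nat.find_spec (hpend q)
  have hout : ∀ q, ∀ i < h q, (q, i) ∈ v.output := by
    intro q i hi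
    by_contra hn
    exact Nat.find_min (hpend q) hi
      (mem_pending.2 ⟨hrec q i _ hi.le (mem_pending.1 (hmem q)).1, hn⟩)
  -- Acks between lowest pending blocks: acyclicity and finiteness of the node set make the descent
  -- terminate.
  let r : Node → Node → Prop := fun q' q => Relation.TransGen L.Acks (q, h q) (q', h q')
  have : IsTrans Node r := ⟨fun _ _ _ hab hbc => hbc.trans hab⟩
  have : Std.Irrefl r := ⟨fun q hq => L.acyclic _ hq⟩
  have wf : WellFounded r := Finite.wellFounded_of_trans_of_irrefl r
  have key : ∀ q, ∃ c ∈ v.candidates L, L.AcksStar (q, h q) c := by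
    intro q
    induction q using wf.induction with
    | _ q ih =>
      by_cases hc : (q, h q) ∈ v.candidates L
      · exact ⟨_, hc, Relation.ReflTransGen.refl⟩
      · have : ∃ b', L.Acks (q, h q) b' ∧ b' ∉ v.output := by
          by_contra! hn
          exact hc (mem_candidates.2 ⟨hmem q, hn⟩)
        obtain ⟨⟨q', i⟩, hacks, hno⟩ := this
        -- The acked block need not have been received. Not being output, it still lies at or above
        -- the lowest pending block of its chain, and so acks it.
        have hi : h q' ≤ i := not_lt.1 fun hlt => hno (hout q' i hlt)
        have htrans : r q' q := Relation.TransGen.head' hacks (L.acksStar_of_le q' hi)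
        obtain ⟨c, hc, hs⟩ := ih q' htrans
        exact ⟨c, hc, htrans.to_reflTransGen.trans hs⟩
  obtain ⟨c, hc, hs⟩ := key q
  refine ⟨c, hc, ?_⟩
  simp only [View.ANS, Finset.mem_filter, Finset.mem_univ, true_and]
  exact Or.inl ⟨h q, hmem q, hs⟩

/-- An integer entry at `q` is the least pending height of `q`, whatever the block, and `⊥` does not
depend on the block either. A strict inequality is thus integer against `∞`. -/
theorem View.AHV_eq_top_of_lt {v : View Node} {L : Blocklattice Node} {p : Node}
    {b₁ b₂ : Block Node} {q : Node} (h : v.AHV L p b₁ q < v.AHV L p b₂ q) :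
    v.AHV L p b₂ q = ((⊤ : ℕ∞) : WithBot ℕ∞) := by
  by_contra hne
  unfold View.AHV at h hne
  by_cases hq : q ∉ v.globalANS L p
  · simp [hq] at h
  · rw [if_neg hq] at h hne
    rw [if_neg hq] at h
    by_cases h₂ : ∃ k : ℕ, v.IsFirstPending q k ∧ L.AcksStar (q, k) b₂
    · rw [dif_pos h₂] at h
      by_cases h₁ : ∃ k : ℕ, v.IsFirstPending q k ∧ L.AcksStar (q, k) b₁
      · rw [dif_pos h₁, h₁.choose_spec.1.unique h₂.choose_spec.1] at h
        exact lt_irrefl _ h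
      · rw [dif_neg h₁] at h
        exact absurd (WithBot.coe_lt_coe.1 h) not_top_lt
    · exact hne (dif_neg h₂)

/-- A block cannot both precede a block and be preceded by one when the threshold exceeds
half of the number of nodes. -/
theorem View.not_lowerCount_and_lowerCount {v : View Node} {L : Blocklattice Node} {Φ : ℕ}
    {p : Node} (hΦ : Fintype.card Node < 2 * (Φ + 1)) {b₁ b₂ b₃ : Block Node}
    (h₁₂ : Φ < v.lowerCount L p b₁ b₂) : ¬ Φ < v.lowerCount L p b₂ b₃ := by
  classical
  intro h₂₃
  have hdisj : Disjoint (Finset.univ.filter fun q : Node => v.AHV L p b₁ q < v.AHV L p b₂ q)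
      (Finset.univ.filter fun q : Node => v.AHV L p b₂ q < v.AHV L p b₃ q) := by
    rw [Finset.disjoint_filter]
    intro q _ h h'
    rw [AHV_eq_top_of_lt h] at h'
    exact absurd h' not_top_lt
  have hcard := Finset.card_le_univ (Finset.disjUnion _ _ hdisj)
  rw [Finset.card_disjUnion] at hcard
  unfold View.lowerCount at h₁₂ h₂₃
  have e₁ : Φ < (Finset.univ.filter fun q : Node =>
      v.AHV L p b₁ q < v.AHV L p b₂ q).card := by convert h₁₂
  have e₂ : Φ < (Finset.univ.filter fun q : Node =>
      v.AHV L p b₂ q < v.AHV L p b₃ q).card := by convert h₂₃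
  omega

theorem View.grade_eq_one {v : View Node} {L : Blocklattice Node} {Φ : ℕ} {p : Node}
    {b₁ b₂ : Block Node} (h : Φ < v.lowerCount L p b₁ b₂) : v.grade L Φ p b₁ b₂ = 1 := by
  simp [View.grade, View.precede, h]

theorem View.grade_eq_zero {v : View Node} {L : Blocklattice Node} {Φ : ℕ} {p : Node}
    (hN : v.NormalStability L p) {b₁ b₂ : Block Node} (h : ¬ Φ < v.lowerCount L p b₁ b₂) :
    v.grade L Φ p b₁ b₂ = 0 := by
  have hp : v.precede L Φ p b₁ b₂ ≠ 1 := by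
    unfold View.precede
    rw [if_neg h]
    split_ifs <;> decide
  unfold View.grade
  rw [if_neg hp, if_pos]
  -- With `|ANS_p| = n` the correction `n - |ANS_p|` vanishes, so the grade is never `⊥`.
  rw [hN]
  push Not at h
  simpa using h

/-- Under normal delivery, a candidate that precedes another one is in the preceding set. -/
theorem View.mem_preceding_of_lowerCount {v : View Node} {L : Blocklattice Node} {Φ : ℕ}
    {p : Node} (hΦ : Fintype.card Node < 2 * (Φ + 1)) (hN : v.NormalStability L p)
    {b b' : Block Node} (hb : b ∈ v.candidates L) (h : Φ < v.lowerCount L p b b') :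
    b ∈ v.preceding L Φ p :=
  mem_preceding.2 ⟨hb, fun _ _ =>
    grade_eq_zero hN fun hc => not_lowerCount_and_lowerCount hΦ hc h⟩

theorem View.internalStability_of_normalStability {v : View Node} {L : Blocklattice Node} {Φ : ℕ}
    {p : Node} (hΦ : Fintype.card Node < 2 * (Φ + 1)) (hN : v.NormalStability L p) :
    v.InternalStability L Φ p := by
  intro b hb hnb
  have : ∃ b' ∈ v.candidates L, Φ < v.lowerCount L p b' b := by
    by_contra! hn
    exact hnb (mem_preceding.2 ⟨hb, fun b' hb' => grade_eq_zero hN (hn b' hb').not_gt⟩)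
  obtain ⟨b', hb', h⟩ := this
  exact ⟨b', mem_preceding_of_lowerCount hΦ hN hb' h, grade_eq_one h⟩

/-- With `f = fmax`, `n ≤ 3f + 3 < 4f + 4 = 2(Φ + 1)`. -/
theorem card_lt_two_mul_threshold_add_one [Nonempty Node] :
    Fintype.card Node < 2 * (threshold Node + 1) := by
  have := Fintype.card_pos (α := Node)
  unfold threshold fmax
  omega

/-- When every chain has a pending block and the received blocks form initial segments of the
chains, the criterion holds and the preceding set is non-empty. -/
theorem View.criterion_and_preceding_nonempty {v : View Node} (L : Blocklattice Node) (p : Node)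
    (hrec : ∀ (q : Node) (i k : ℕ), i ≤ k → (q, k) ∈ v.received → (q, i) ∈ v.received)
    (hpend : ∀ q : Node, ∃ k, (q, k) ∈ v.pending) :
    v.Criterion L (threshold Node) p ∧ (v.preceding L (threshold Node) p).Nonempty := by
  have : Nonempty Node := ⟨p⟩
  have hANS := View.exists_candidate_mem_ANS L p hrec hpend
  have hN : v.NormalStability L p := by
    have : v.globalANS L p = Finset.univ := by
      refine Finset.eq_univ_of_forall fun q => ?_
      simpa [View.globalANS] using hANS q
    rw [View.NormalStability, this, Finset.card_univ]
  have hI := View.internalStability_of_normalStability card_lt_two_mul_threshold_add_one hN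
  refine ⟨⟨hI, Or.inl hN⟩, ?_⟩
  obtain ⟨c, hc, -⟩ := hANS p
  by_cases h : c ∈ v.preceding L (threshold Node) p
  · exact ⟨c, h⟩
  · obtain ⟨b, hb, -⟩ := hI c hc h
    exact ⟨b, hb⟩

end Views

/-! ### Timing of receipts and order of the input. -/

namespace Run

variable {Node : Type*} [Fintype Node]

/-- A correct node receives a block of every chain in every interval of length `2 ΔBA + lam`. -/
theorem BATimeBound.exists_recvTime_mem_Icc {S : Run Node} {ΔBA lam : ℝ}
    (h : S.BATimeBound ΔBA lam) {p : Node} (hp : p ∉ S.byzantine) {a b : ℝ} (ha : 0 ≤ a)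
    (hab : 2 * ΔBA + lam ≤ b - a) (j : Node) : ∃ k, S.recvTime p (j, k) ∈ Set.Icc a b := by
  classical
  have hex : ∃ k, a ≤ S.recvTime p (j, k) := by
    by_contra! hn
    refine Set.infinite_of_injective_forall_mem (f := fun k : ℕ => (j, k))
      (fun _ _ e => (Prod.mk.inj e).2) (fun k => ?_) (S.recv_finite p hp a)
    exact (hn k).le
  -- Take the first block of the chain received at or after `a`. Its agreement was under way by time
  -- `a`: either its height is 0, or its predecessor was received before `a`. One `ΔBA` for the
  -- issue and `ΔBA + lam` for the receipt give the bound.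
  refine ⟨Nat.find hex, Nat.find_spec hex, ?_⟩
  rcases hk : Nat.find hex with _ | k
  · have h₁ := h.issue_first j
    have h₂ := h.recv_le p hp (j, 0)
    linarith
  · have h₀ := not_le.1 (Nat.find_min hex (m := k) (by omega))
    have h₁ := h.issue_next p hp j k
    have h₂ := h.recv_le p hp (j, k + 1)
    linarith

theorem IsInputOrder.le_of_height_le {S : Run Node} {p : Node} {inp : ℕ → Block Node}
    (h : S.IsInputOrder p inp) {m m' : ℕ} {q : Node} {i k : ℕ} (hik : i ≤ k)
    (hm : inp m = (q, k)) (hm' : inp m' = (q, i)) : m' ≤ m := by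
  by_contra! hlt
  have := h.height_mono m m' hlt (by rw [hm, hm'])
  rw [hm, hm'] at this
  exact absurd this (not_lt.2 hik)

end Run

end Dexon

theorem mainTheorem4 {Node : Type*} [Fintype Node] (S : Dexon.Run Node)
    (p : Node) (hp : p ∉ S.byzantine) (ΔBA lam : ℝ) (hBA : S.BATimeBound ΔBA lam)
    (inp : ℕ → Dexon.Block Node) (hinp : S.IsInputOrder p inp)
    (a b : ℝ) (ha : 0 ≤ a) (hab : 2 * ΔBA + lam ≤ b - a) :
    ∃ t ∈ Set.Icc a b, ∃ B : Finset (Dexon.Block Node),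
      S.CriterionAt p inp t B ∧ B.Nonempty := by
  classical
  by_contra hcon
  have hno : ∀ m, S.recvTime p (inp m) ∈ Set.Icc a b →
      let v := (Dexon.viewAfter S.lattice (Dexon.threshold Node) p inp m).receive (inp m)
      v.Criterion S.lattice (Dexon.threshold Node) p →
        ¬ (v.preceding S.lattice (Dexon.threshold Node) p).Nonempty :=
    -- Round `0` is the view right after the receipt, before any output.
    fun m hm hc hne => hcon ⟨_, hm, _, ⟨m, 0, rfl, hc, rfl⟩, hne⟩
  have hfirst : ∀ j, ∃ m, S.recvTime p (inp m) ∈ Set.Icc a b ∧ (inp m).1 = j := by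
    intro j
    obtain ⟨k, hk⟩ := hBA.exists_recvTime_mem_Icc hp ha hab j
    obtain ⟨m, hm⟩ := hinp.bijective.surjective (j, k)
    exact ⟨m, by rwa [hm], by rw [hm]⟩
  choose idx hidx hidx' using hfirst
  have : Nonempty Node := ⟨p⟩
  -- `idx j₀` and `idx j₁` are the first and last input positions of the chosen blocks; everything
  -- between them is received within `[a, b]`.
  obtain ⟨j₀, hj₀⟩ := Finite.exists_min idx
  obtain ⟨j₁, hj₁⟩ := Finite.exists_max idx
  have hIcc : ∀ i, idx j₀ ≤ i → i ≤ idx j₁ → S.recvTime p (inp i) ∈ Set.Icc a b :=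
    fun i h₀ h₁ => ⟨(hidx j₀).1.trans (hinp.recv_mono _ _ h₀),
      (hinp.recv_mono _ _ h₁).trans (hidx j₁).2⟩
  set w := Dexon.viewAfter S.lattice (Dexon.threshold Node) p inp with hw
  have hout : (w (idx j₁)).output = (w (idx j₀)).output :=
    Dexon.output_viewAfter_eq (hj₀ j₁) fun i h₀ h₁ => hno i (hIcc i h₀ h₁.le)
  have hrec : ∀ x, x ∈ ((w (idx j₁)).receive (inp (idx j₁))).received ↔
      ∃ i ≤ idx j₁, inp i = x := by
    intro x
    rw [Dexon.View.receive, Finset.mem_insert, hw, Dexon.mem_received_viewAfter]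
    constructor
    · rintro (rfl | ⟨i, hi, rfl⟩)
      · exact ⟨_, le_rfl, rfl⟩
      · exact ⟨i, hi.le, rfl⟩
    · rintro ⟨i, hi, rfl⟩
      rcases hi.lt_or_eq with hi | rfl
      · exact Or.inr ⟨i, hi, rfl⟩
      · exact Or.inl rfl
  have hmain := Dexon.View.criterion_and_preceding_nonempty S.lattice p
    (fun q i k hik hk => by
      obtain ⟨m, hm, e⟩ := (hrec _).1 hk
      obtain ⟨m', e'⟩ := hinp.bijective.surjective (q, i)
      exact (hrec _).2 ⟨m', (hinp.le_of_height_le hik e e').trans hm, e'⟩)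
    (fun q => by
      refine ⟨(inp (idx q)).2, Dexon.View.mem_pending.2 ?_⟩
      have e : (q, (inp (idx q)).2) = inp (idx q) :=
        Prod.ext (hidx' q).symm rfl
      rw [e]
      refine ⟨(hrec _).2 ⟨_, hj₁ q, rfl⟩, fun hmem => ?_⟩
      -- An output chosen block would have been output already before input `idx j₀`, hence received
      -- at an earlier position, although `idx j₀` is the least.
      have hmem' : inp (idx q) ∈ (w (idx j₀)).output := hout ▸ hmem
      obtain ⟨i, hi, e'⟩ := Dexon.mem_received_viewAfter.1
        (Dexon.output_subset_received_viewAfter _ _ _ _ _ hmem')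
      rw [hinp.bijective.injective e'] at hi
      exact absurd (hj₀ q) hi.not_ge)
  exact hno (idx j₁) (hIcc _ (hj₀ j₁) le_rfl) hmain.1 hmain.2
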